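/- Let $G$ be an $r$-regular simple graph (not necessarily connected) with $n\ge 2$ vertices and $m$ edges, and let $\lambda_1\ge\lambda_2\ge\dots\ge\lambda_n$ be the eigenvalues of its adjacency matrix, with multiplicity. Let $C(G)$ be the central graph of $G$, obtained from $G$ by subdividing each edge of $G$ exactly once and joining all pairs of distinct vertices of $G$ that are not adjacent in $G$. For a connected graph $H$ with vertices $v_1,\dots,v_N$ of degrees $d_1,\dots,d_N$, the degree Kirchhoff index is $Kf^*(H)=\sum_{i<j}d_i\,r^*_{i,j}\,d_j$, where $r^*_{i,j}$ is the resistance distance, i.e. the effective resistance between $v_i$ and $v_j$ when every edge of $H$ is a unit resistor. Then $C(G)$ is connected and $$Kf^*(C(G))=\bigl(2m+n(n-1)\bigr)\left[m-n+\frac{n-1}{n-1+r}+\sum_{i=2}^{n}\frac{2(2n+\lambda_i-1)}{2n+\lambda_i-r}\right].$$ -/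

import Mathlib

namespace SimpleGraph

/-- The central graph `C(G)`: subdivide each edge of `G` exactly once (the new vertices are the
edges of `G`) and join all pairs of distinct vertices of `G` that are not adjacent in `G`. -/
def centralGraph {V : Type*} (G : SimpleGraph V) : SimpleGraph (V ⊕ G.edgeSet) where
  Adj
    | Sum.inl u, Sum.inl v => u ≠ v ∧ ¬ G.Adj u v
    | Sum.inl u, Sum.inr e => u ∈ (e : Sym2 V)
    | Sum.inr e, Sum.inl u => u ∈ (e : Sym2 V)
    | Sum.inr _, Sum.inr _ => False
  symm := ⟨by
    rintro (u | e) (v | f) h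
    · exact ⟨h.1.symm, fun h' => h.2 h'.symm⟩
    · exact h
    · exact h
    · exact h⟩
  loopless := ⟨by
    rintro (u | e) h
    · exact h.1 rfl
    · exact h⟩

instance centralGraph.decidableAdj {V : Type*} [DecidableEq V] (G : SimpleGraph V)
    [DecidableRel G.Adj] : DecidableRel (centralGraph G).Adj
  | Sum.inl u, Sum.inl v => inferInstanceAs (Decidable (u ≠ v ∧ ¬ G.Adj u v))
  | Sum.inl u, Sum.inr e => inferInstanceAs (Decidable (u ∈ (e : Sym2 V)))
  | Sum.inr e, Sum.inl u => inferInstanceAs (Decidable (u ∈ (e : Sym2 V)))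
  | Sum.inr _, Sum.inr _ => inferInstanceAs (Decidable False)

section

variable {V : Type*} [Fintype V] [DecidableEq V] (G : SimpleGraph V) [DecidableRel G.Adj]

/-- `φ` is an electric potential on the network with a unit resistor on every edge of `G`, when a
unit current enters at `a` and leaves at `b`. By Ohm's law the current from `v` to a neighbour `w`
is `φ v - φ w`, so the net current out of `v` is `(L φ) v`, with `L` the Laplacian matrix, and
Kirchhoff's current law is the equation `L φ = δ_a - δ_b`. -/
def IsUnitCurrentPotential (a b : V) (φ : V → ℝ) : Prop :=
  (G.lapMatrix ℝ).mulVec φ = Pi.single a 1 - Pi.single b 1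

/-- The potential difference between `a` and `b` is the same for all such potentials. -/
theorem IsUnitCurrentPotential.sub_eq {G : SimpleGraph V} [DecidableRel G.Adj] {a b : V}
    {φ ψ : V → ℝ} (hφ : G.IsUnitCurrentPotential a b φ) (hψ : G.IsUnitCurrentPotential a b ψ) :
    φ a - φ b = ψ a - ψ b := by
  have h : dotProduct ψ ((G.lapMatrix ℝ).mulVec φ) = dotProduct φ ((G.lapMatrix ℝ).mulVec ψ) := by
    rw [Matrix.dotProduct_mulVec, ← Matrix.mulVec_transpose, (G.isSymm_lapMatrix (R := ℝ)).eq,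
      dotProduct_comm]
  rw [IsUnitCurrentPotential] at hφ hψ
  rw [hφ, hψ] at h
  simpa [dotProduct_sub] using h.symm

open Classical in
/-- The resistance distance between `a` and `b`: the effective resistance when every edge of `G`
is a unit resistor, i.e. the potential difference between `a` and `b` that drives a unit current
from `a` to `b`. Such a potential exists whenever `G` is connected, and the value does not depend
on the chosen one (`IsUnitCurrentPotential.sub_eq`). The value is `0` if there is none. -/
noncomputable def resistanceDist (a b : V) : ℝ :=
  if h : ∃ φ : V → ℝ, G.IsUnitCurrentPotential a b φ then h.choose a - h.choose b else 0

theorem IsUnitCurrentPotential.resistanceDist_eq {G : SimpleGraph V} [DecidableRel G.Adj]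
    {a b : V} {φ : V → ℝ} (hφ : G.IsUnitCurrentPotential a b φ) :
    G.resistanceDist a b = φ a - φ b := by
  have h : ∃ φ : V → ℝ, G.IsUnitCurrentPotential a b φ := ⟨φ, hφ⟩
  rw [resistanceDist, dif_pos h]
  exact h.choose_spec.sub_eq hφ

/-- The degree Kirchhoff index: the sum over unordered pairs of distinct vertices of
`d_u * r_{u,v} * d_v`. It is written as half of the sum over ordered pairs; the diagonal terms
vanish since `r_{u,u} = 0`. -/
noncomputable def degreeKirchhoffIndex : ℝ :=
  (1 / 2) * ∑ u : V, ∑ v : V, (G.degree u : ℝ) * G.resistanceDist u v * (G.degree v : ℝ)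

/-- The adjacency eigenvalues of `G` with multiplicity, in decreasing order, indexed from `0`. -/
noncomputable def adjEigenvalue : Fin (Fintype.card V) → ℝ :=
  (G.isHermitian_adjMatrix (R := ℝ)).eigenvalues₀

end

end SimpleGraph

/-!
The proof exhibits a symmetric Green matrix `g` of the central graph `C(G)`, that is,
`L g = 1 - c 1ᵀ` for the Laplacian `L` of `C(G)` and some vector `c`. Differences of columns of `g`
are unit current potentials, so that `r_{u,v} = g_{uu} + g_{vv} - 2 g_{uv}`, and summing against the
degrees `d` gives `Kf* = (∑ d_v) (∑ d_v g_{vv}) - dᵀ g d`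
(`SimpleGraph.degreeKirchhoffIndex_eq_of_lapMatrix_mul`).

Let `A` be the adjacency matrix, `B` the vertex-edge incidence matrix of the `r`-regular graph `G`,
and `J` the all-ones matrix. The vertices of `G` have degree `n - 1` in `C(G)` and the subdivision
vertices have degree `2`, so that `L` has the blocks `n - J + A`, `-B`, `-Bᵀ` and `2`. By
`B Bᵀ = r + A`, the Schur complement of the last block is `M / 2 - J` with `M = (2n - r) + A`. As
`M 1 = 2n 1`, the matrix `N = 2 M⁻¹` satisfies `(M / 2 - J) N = 1 - J / n`, and block elimination
gives `g` (`SimpleGraph.IsRegularOfDegree.lapMatrix_mul_centralGreen`).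

The quadratic form `dᵀ g d` only involves `N 1 = (1 / n) 1`, while `B Bᵀ = r + A` and `N M = 2` give
`∑ d_v g_{vv} = (r - 1) tr N + m + n`. Finally `tr N = ∑ 2 / (2n - r + λ_i)` by the spectral theorem
(`Matrix.IsHermitian.trace_inv_smul_one_add`). The summand with `i = 1` is split off by `λ_1 = r`.
Both this and the invertibility of `M` rest on `-r ≤ λ_i ≤ r`, which holds because the Laplacian
`r - A` and the signless Laplacian `r + A = B Bᵀ` are positive semidefinite.
-/

open Matrix

/-! ### Symmetric matrices shifted by a scalar -/

/-- If `c + λ ≠ 0` for every eigenvalue `λ` of a real symmetric matrix `A`, then `c • 1 + A` is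
invertible, and the trace of its inverse is the sum of the `(c + λ)⁻¹`. -/
theorem Matrix.IsHermitian.trace_inv_smul_one_add {V : Type*} [Fintype V] [DecidableEq V]
    {A : Matrix V V ℝ} (hA : A.IsHermitian) (c : ℝ) (hc : ∀ i, c + hA.eigenvalues i ≠ 0) :
    (c • 1 + A) * (c • 1 + A)⁻¹ = 1 ∧
      (c • 1 + A)⁻¹.trace = ∑ i, (c + hA.eigenvalues i)⁻¹ := by
  set U : Matrix V V ℝ := ↑hA.eigenvectorUnitary
  have hUU : U * star U = 1 := Unitary.mul_star_self_of_mem hA.eigenvectorUnitary.2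
  have hUU' : star U * U = 1 := Unitary.star_mul_self_of_mem hA.eigenvectorUnitary.2
  have hspec : A = U * diagonal hA.eigenvalues * star U := by
    have h := hA.spectral_theorem
    rw [Unitary.conjStarAlgAut_apply] at h
    exact h
  have hM : c • 1 + A = U * diagonal (fun i => c + hA.eigenvalues i) * star U := by
    have h1 : diagonal (fun i => c + hA.eigenvalues i) = c • 1 + diagonal hA.eigenvalues := by
      rw [← diagonal_one, ← diagonal_smul, diagonal_add]
      congr 1
      ext i
      simp
    rw [h1, Matrix.mul_add, Matrix.add_mul, ← hspec, Matrix.mul_smul, Matrix.mul_one,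
      Matrix.smul_mul, hUU]
  have hinv : (c • 1 + A) *
      (U * diagonal (fun i => (c + hA.eigenvalues i)⁻¹) * star U) = 1 := by
    rw [hM]
    calc _ = U * (diagonal (fun i => c + hA.eigenvalues i) * (star U * U) *
          diagonal (fun i => (c + hA.eigenvalues i)⁻¹)) * star U := by
          simp only [Matrix.mul_assoc]
      _ = 1 := by
          rw [hUU', Matrix.mul_one, diagonal_mul_diagonal]
          simp only [mul_inv_cancel₀ (hc _), diagonal_one, Matrix.mul_one, hUU]
  rw [Matrix.inv_eq_right_inv hinv]
  refine ⟨hinv, ?_⟩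
  rw [Matrix.trace_mul_comm, ← Matrix.mul_assoc, hUU', Matrix.one_mul, trace_diagonal]

theorem Matrix.IsHermitian.eigenvalues_nonneg_of_posSemidef_smul_one_add {V : Type*}
    [Fintype V] [DecidableEq V] {A : Matrix V V ℝ} (hA : A.IsHermitian) {c s : ℝ}
    (h : (c • 1 + s • A).PosSemidef) (i : V) :
    0 ≤ c + s * hA.eigenvalues i := by
  set v : V → ℝ := ⇑(hA.eigenvectorBasis i) with hv
  have hAv : A *ᵥ v = hA.eigenvalues i • v := hA.mulVec_eigenvectorBasis i
  have hv1 : v ⬝ᵥ v = 1 := by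
    have := hA.eigenvectorBasis.orthonormal.1 i
    have h2 := EuclideanSpace.real_norm_sq_eq (hA.eigenvectorBasis i)
    rw [this] at h2
    simp only [dotProduct, ← sq, hv]
    linarith
  have h3 := h.dotProduct_mulVec_nonneg v
  simpa [Matrix.add_mulVec, Matrix.smul_mulVec, hAv, dotProduct_add, hv1] using h3

namespace SimpleGraph

/-! ### Resistance distances from a Green matrix -/

section Resistance

variable {V : Type*} [Fintype V] [DecidableEq V] {G : SimpleGraph V} [DecidableRel G.Adj]

/-- A symmetric `g` whose columns `g_b` satisfy `L g_b = δ_b - c` with a fixed `c` plays the role of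
a Green function: `g_a - g_b` is a unit current potential. -/
theorem resistanceDist_eq_of_lapMatrix_mul {g : Matrix V V ℝ} {c : V → ℝ} (hsymm : gᵀ = g)
    (hg : G.lapMatrix ℝ * g = 1 - vecMulVec c 1) (a b : V) :
    G.resistanceDist a b = g a a + g b b - 2 * g a b := by
  have key : ∀ b : V, (G.lapMatrix ℝ).mulVec (g.col b) = Pi.single b 1 - c := by
    intro b
    ext v
    have h := congrFun (congrFun hg v) b
    rw [Matrix.mul_apply] at h
    simp only [mulVec, dotProduct, col_apply]
    rw [h]
    simp [Matrix.one_apply, Pi.single_apply]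
  have hφ : G.IsUnitCurrentPotential a b (g.col a - g.col b) := by
    rw [IsUnitCurrentPotential, Matrix.mulVec_sub, key, key]
    abel
  rw [hφ.resistanceDist_eq]
  have hab : g b a = g a b := congrFun (congrFun hsymm a) b
  simp only [Pi.sub_apply, col_apply, hab]
  ring

/-- Summing `r_{u,v} = g_{uu} + g_{vv} - 2 g_{uv}` against the degrees leaves only the
degree-weighted trace and the quadratic form of a Green matrix. -/
theorem degreeKirchhoffIndex_eq_of_lapMatrix_mul {g : Matrix V V ℝ} {c : V → ℝ} (hsymm : gᵀ = g)
    (hg : G.lapMatrix ℝ * g = 1 - vecMulVec c 1) {d : V → ℝ} (hd : ∀ v, (G.degree v : ℝ) = d v) :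
    G.degreeKirchhoffIndex = (∑ v, d v) * ∑ v, d v * g v v - d ⬝ᵥ g *ᵥ d := by
  have h1 : ∑ u, ∑ v, d u * (g u u + g v v - 2 * g u v) * d v =
      (∑ u, d u * g u u) * (∑ v, d v) + (∑ u, d u) * (∑ v, d v * g v v) -
        2 * (d ⬝ᵥ g *ᵥ d) := by
    rw [Finset.sum_mul_sum, Finset.sum_mul_sum]
    simp only [dotProduct, mulVec, Finset.mul_sum, ← Finset.sum_add_distrib,
      ← Finset.sum_sub_distrib]
    refine Finset.sum_congr rfl fun u _ => Finset.sum_congr rfl fun v _ => ?_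
    ring
  simp only [degreeKirchhoffIndex, hd, resistanceDist_eq_of_lapMatrix_mul hsymm hg, h1]
  ring

end Resistance

/-! ### Spectrum of a regular graph -/

theorem IsRegularOfDegree.adjMatrix_mulVec_one {V : Type*} [Fintype V] {G : SimpleGraph V}
    [DecidableRel G.Adj] {r : ℕ} (hr : G.IsRegularOfDegree r) :
    G.adjMatrix ℝ *ᵥ 1 = (r : ℝ) • 1 := by
  ext v
  simpa [Function.const_def] using
    adjMatrix_mulVec_const_apply_of_regular (a := (1 : ℝ)) hr (v := v)

section Spectrum

variable {V : Type*} [Fintype V] [DecidableEq V] {G : SimpleGraph V} [DecidableRel G.Adj]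

theorem IsRegularOfDegree.degMatrix_eq {r : ℕ} (hr : G.IsRegularOfDegree r) :
    G.degMatrix ℝ = (r : ℝ) • 1 := by
  ext i j
  simp [degMatrix, diagonal_apply, Matrix.one_apply, hr.degree_eq]

theorem IsRegularOfDegree.incMatrix_mul_transpose {r : ℕ} (hr : G.IsRegularOfDegree r) :
    G.incMatrix ℝ * (G.incMatrix ℝ)ᵀ = (r : ℝ) • 1 + G.adjMatrix ℝ := by
  rw [SimpleGraph.incMatrix_mul_transpose]
  ext i j
  by_cases h : i = j
  · subst h
    simp [hr.degree_eq]
  · simp [h, adjMatrix_apply]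

/-- The signless Laplacian `r + A = B Bᵀ` is positive semidefinite. -/
theorem IsRegularOfDegree.neg_le_eigenvalues {r : ℕ} (hr : G.IsRegularOfDegree r) (i : V) :
    -(r : ℝ) ≤ (G.isHermitian_adjMatrix (R := ℝ)).eigenvalues i := by
  have h := posSemidef_self_mul_conjTranspose (G.incMatrix ℝ)
  rw [conjTranspose_eq_transpose_of_trivial, hr.incMatrix_mul_transpose,
    ← one_smul ℝ (G.adjMatrix ℝ)] at h
  have := (G.isHermitian_adjMatrix (R := ℝ)).eigenvalues_nonneg_of_posSemidef_smul_one_add h i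
  linarith

/-- The Laplacian `r - A` is positive semidefinite. -/
theorem IsRegularOfDegree.eigenvalues_le {r : ℕ} (hr : G.IsRegularOfDegree r) (i : V) :
    (G.isHermitian_adjMatrix (R := ℝ)).eigenvalues i ≤ r := by
  have h := G.posSemidef_lapMatrix ℝ
  rw [lapMatrix, hr.degMatrix_eq, sub_eq_add_neg, ← neg_one_smul ℝ (G.adjMatrix ℝ)] at h
  have := (G.isHermitian_adjMatrix (R := ℝ)).eigenvalues_nonneg_of_posSemidef_smul_one_add h i
  linarith

theorem sum_adjEigenvalue (f : ℝ → ℝ) :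
    ∑ i, f (G.adjEigenvalue i) =
      ∑ i, f ((G.isHermitian_adjMatrix (R := ℝ)).eigenvalues i) := by
  unfold adjEigenvalue Matrix.IsHermitian.eigenvalues
  exact (Equiv.sum_comp _ fun j => f ((G.isHermitian_adjMatrix (R := ℝ)).eigenvalues₀ j)).symm

/-- The constant vector shows that `r` is an eigenvalue, and no eigenvalue exceeds `r`. -/
theorem IsRegularOfDegree.adjEigenvalue_eq_of_val_eq_zero {r : ℕ} (hr : G.IsRegularOfDegree r)
    (i : Fin (Fintype.card V)) (hi : (i : ℕ) = 0) : G.adjEigenvalue i = r := by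
  have hA := G.isHermitian_adjMatrix (R := ℝ)
  have hne : Nonempty V := Fintype.card_pos_iff.mp i.pos
  have hle : ∀ j, G.adjEigenvalue j ≤ r := by
    intro j
    obtain ⟨v, rfl⟩ := (Fintype.equivOfCardEq (Fintype.card_fin _) :
      Fin (Fintype.card V) ≃ V).symm.surjective j
    exact hr.eigenvalues_le v
  have hmem : (r : ℝ) ∈ spectrum ℝ (G.adjMatrix ℝ) := by
    rw [← Matrix.spectrum_toLin']
    refine (Module.End.hasEigenvalue_of_hasEigenvector (x := 1) ?_).mem_spectrum
    rw [Module.End.hasEigenvector_iff, Module.End.mem_eigenspace_iff]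
    exact ⟨by simpa using hr.adjMatrix_mulVec_one, one_ne_zero⟩
  rw [hA.spectrum_real_eq_range_eigenvalues] at hmem
  obtain ⟨v, hv⟩ := hmem
  refine le_antisymm (hle i) ?_
  rw [← hv]
  exact hA.eigenvalues₀_antitone (Fin.le_def.mpr (by omega))

theorem IsRegularOfDegree.sum_adjEigenvalue_filter {r : ℕ} (hr : G.IsRegularOfDegree r)
    [Nonempty V] (f : ℝ → ℝ) :
    ∑ i ∈ Finset.univ.filter (fun i : Fin (Fintype.card V) => 1 ≤ (i : ℕ)),
        f (G.adjEigenvalue i) =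
      ∑ i, f ((G.isHermitian_adjMatrix (R := ℝ)).eigenvalues i) - f r := by
  rw [← sum_adjEigenvalue]
  have h0 : Finset.univ.filter (fun i : Fin (Fintype.card V) => 1 ≤ (i : ℕ)) =
      Finset.univ.erase ⟨0, Fintype.card_pos⟩ := by
    ext i
    simp only [Finset.mem_filter, Finset.mem_univ, true_and, Finset.mem_erase, and_true, ne_eq,
      Fin.ext_iff]
    omega
  rw [h0, Finset.sum_erase_eq_sub (Finset.mem_univ _),
    hr.adjEigenvalue_eq_of_val_eq_zero ⟨0, Fintype.card_pos⟩ rfl]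

end Spectrum

/-! ### The vertex-edge incidence matrix -/

section Incidence

variable {V : Type*} [DecidableEq V] (G : SimpleGraph V) [DecidableRel G.Adj]

/-- The vertex-edge incidence matrix, with columns indexed by the edges of `G` only
(`SimpleGraph.incMatrix` has a column for every element of `Sym2 V`). -/
def edgeIncMatrix : Matrix V G.edgeSet ℝ :=
  (G.incMatrix ℝ).submatrix id Subtype.val

theorem edgeIncMatrix_apply (v : V) (e : G.edgeSet) :
    G.edgeIncMatrix v e = if v ∈ (e : Sym2 V) then 1 else 0 := by
  simp [edgeIncMatrix, incMatrix_apply', incidenceSet, e.2]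

variable [Fintype V]

theorem edgeIncMatrix_mul_transpose :
    G.edgeIncMatrix * G.edgeIncMatrixᵀ = G.incMatrix ℝ * (G.incMatrix ℝ)ᵀ := by
  ext u v
  simp only [Matrix.mul_apply, transpose_apply, edgeIncMatrix, submatrix_apply, id]
  have hf : ∀ e ∉ G.edgeSet, G.incMatrix ℝ u e * G.incMatrix ℝ v e = 0 := by
    intro e he
    rw [G.incMatrix_of_notMem_incidenceSet fun h => he h.1, zero_mul]
  refine Finset.sum_of_injOn Subtype.val Subtype.val_injective.injOn (by simp) ?_ (by simp)
  intro e _ he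
  refine hf e fun h => he ?_
  simpa using h

theorem one_vecMul_edgeIncMatrix : 1 ᵥ* G.edgeIncMatrix = (2 : ℝ) • 1 := by
  ext e
  simpa [vecMul, dotProduct, edgeIncMatrix] using
    G.sum_incMatrix_apply_of_mem_edgeSet (R := ℝ) e.2

variable {G}

theorem IsRegularOfDegree.edgeIncMatrix_mulVec_one {r : ℕ} (hr : G.IsRegularOfDegree r) :
    G.edgeIncMatrix *ᵥ 1 = (r : ℝ) • 1 := by
  have h : G.edgeIncMatrix *ᵥ ((2 : ℝ) • 1) = (2 : ℝ) • ((r : ℝ) • 1) := by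
    rw [← one_vecMul_edgeIncMatrix, ← mulVec_transpose, mulVec_mulVec,
      edgeIncMatrix_mul_transpose, hr.incMatrix_mul_transpose, add_mulVec,
      hr.adjMatrix_mulVec_one, smul_mulVec, one_mulVec, two_smul]
  rw [mulVec_smul] at h
  exact smul_right_injective _ two_ne_zero h

end Incidence

/-! ### The Laplacian and a Green matrix of the central graph -/

section CentralGraph

variable {V : Type*} {G : SimpleGraph V}

theorem centralGraph_connected [Nonempty V] : G.centralGraph.Connected := by
  have hinl : ∀ u v : V, G.centralGraph.Reachable (Sum.inl u) (Sum.inl v) := by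
    intro u v
    by_cases huv : u = v
    · rw [huv]
    by_cases hadj : G.Adj u v
    · let e : G.edgeSet := ⟨s(u, v), hadj⟩
      have h1 : G.centralGraph.Adj (Sum.inl u) (Sum.inr e) := Sym2.mem_mk_left u v
      have h2 : G.centralGraph.Adj (Sum.inr e) (Sum.inl v) := Sym2.mem_mk_right u v
      exact h1.reachable.trans h2.reachable
    · have h : G.centralGraph.Adj (Sum.inl u) (Sum.inl v) := ⟨huv, hadj⟩
      exact h.reachable
  have hinr : ∀ e : G.edgeSet, ∃ u : V, G.centralGraph.Reachable (Sum.inr e) (Sum.inl u) := by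
    rintro ⟨e, he⟩
    induction e with
    | h u v =>
      have h : G.centralGraph.Adj (Sum.inr ⟨s(u, v), he⟩) (Sum.inl u) := Sym2.mem_mk_left u v
      exact ⟨u, h.reachable⟩
  have hex : ∀ x, ∃ u : V, G.centralGraph.Reachable x (Sum.inl u) := by
    rintro (u | e)
    · exact ⟨u, .rfl⟩
    · exact hinr e
  have : Nonempty (V ⊕ G.edgeSet) := inferInstance
  refine ⟨fun x y => ?_⟩
  obtain ⟨u, hu⟩ := hex x
  obtain ⟨v, hv⟩ := hex y
  exact hu.trans ((hinl u v).trans hv.symm)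

variable [DecidableEq V] [DecidableRel G.Adj]

theorem adjMatrix_centralGraph :
    G.centralGraph.adjMatrix ℝ =
      fromBlocks (vecMulVec 1 1 - 1 - G.adjMatrix ℝ) G.edgeIncMatrix G.edgeIncMatrixᵀ 0 := by
  ext (u | e) (v | f)
  · have h : G.centralGraph.Adj (Sum.inl u) (Sum.inl v) ↔ u ≠ v ∧ ¬ G.Adj u v := Iff.rfl
    by_cases huv : u = v
    · subst huv
      simp [adjMatrix_apply]
    · by_cases hadj : G.Adj u v <;>
        simp [adjMatrix_apply, h, huv, hadj]
  · have h : G.centralGraph.Adj (Sum.inl u) (Sum.inr f) ↔ u ∈ (f : Sym2 V) := Iff.rfl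
    simp [adjMatrix_apply, h, edgeIncMatrix_apply]
  · have h : G.centralGraph.Adj (Sum.inr e) (Sum.inl v) ↔ v ∈ (e : Sym2 V) := Iff.rfl
    simp [adjMatrix_apply, h, edgeIncMatrix_apply]
  · have h : G.centralGraph.Adj (Sum.inr e) (Sum.inr f) ↔ False := Iff.rfl
    simp [adjMatrix_apply, h]

variable [Fintype V]

theorem IsRegularOfDegree.degree_centralGraph {r : ℕ} (hr : G.IsRegularOfDegree r)
    (x : V ⊕ G.edgeSet) :
    (G.centralGraph.degree x : ℝ) =
      Sum.elim (((Fintype.card V : ℝ) - 1) • (1 : V → ℝ))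
        ((2 : ℝ) • (1 : G.edgeSet → ℝ)) x := by
  have h := adjMatrix_mulVec_const_apply (G := G.centralGraph) (a := (1 : ℝ)) (v := x)
  rw [mul_one] at h
  rw [← h, adjMatrix_centralGraph]
  have h1 : Function.const (V ⊕ G.edgeSet) (1 : ℝ) =
      Sum.elim (1 : V → ℝ) (1 : G.edgeSet → ℝ) := by
    ext (u | e) <;> rfl
  have h2 : G.edgeIncMatrixᵀ *ᵥ 1 = (2 : ℝ) • 1 := by
    rw [mulVec_transpose, one_vecMul_edgeIncMatrix]
  rw [h1, fromBlocks_mulVec]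
  simp only [Sum.elim_comp_inl, Sum.elim_comp_inr]
  rw [hr.edgeIncMatrix_mulVec_one, h2, sub_mulVec, sub_mulVec, hr.adjMatrix_mulVec_one,
    vecMulVec_mulVec]
  congr 1
  · ext v
    simp
  · simp

theorem IsRegularOfDegree.lapMatrix_centralGraph {r : ℕ} (hr : G.IsRegularOfDegree r) :
    G.centralGraph.lapMatrix ℝ =
      fromBlocks ((Fintype.card V : ℝ) • 1 - vecMulVec 1 1 + G.adjMatrix ℝ) (-G.edgeIncMatrix)
        (-G.edgeIncMatrixᵀ) ((2 : ℝ) • 1) := by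
  have hD : G.centralGraph.degMatrix ℝ =
      fromBlocks (((Fintype.card V : ℝ) - 1) • 1) 0 0 ((2 : ℝ) • 1) := by
    rw [degMatrix, funext hr.degree_centralGraph]
    ext (u | e) (v | f) <;> simp [diagonal_apply, Matrix.one_apply]
  rw [lapMatrix, hD, adjMatrix_centralGraph, sub_eq_add_neg, fromBlocks_neg, fromBlocks_add]
  congr 1
  · rw [sub_smul, one_smul]
    abel
  · simp
  · simp
  · simp

/-- A generalized inverse of the Laplacian of the central graph, for `N` twice the inverse of
`(2n - r) + A`. The Schur complement of the edge block of the Laplacian is then `N⁻¹ - J`, with `J`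
the all-ones matrix, and `N` serves as a generalized inverse of it; the other blocks come from block
elimination. -/
noncomputable def centralGreen (G : SimpleGraph V) [DecidableRel G.Adj] (N : Matrix V V ℝ) :
    Matrix (V ⊕ G.edgeSet) (V ⊕ G.edgeSet) ℝ :=
  fromBlocks N ((1 / 2 : ℝ) • (N * G.edgeIncMatrix)) ((1 / 2 : ℝ) • (G.edgeIncMatrixᵀ * N))
    ((1 / 2 : ℝ) • 1 + (1 / 4 : ℝ) • (G.edgeIncMatrixᵀ * N * G.edgeIncMatrix))

theorem transpose_centralGreen {N : Matrix V V ℝ} (hN : Nᵀ = N) :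
    (G.centralGreen N)ᵀ = G.centralGreen N := by
  simp only [centralGreen, fromBlocks_transpose, transpose_smul, transpose_mul, transpose_add,
    transpose_one, transpose_transpose, hN, Matrix.mul_assoc]

variable {r : ℕ} {N : Matrix V V ℝ}

/-- The row sums of `(2n - r) + A` are `2n`. -/
theorem IsRegularOfDegree.mulVec_one_of_mul_eq (hr : G.IsRegularOfDegree r) [Nonempty V]
    (hN : N * ((2 * Fintype.card V - r : ℝ) • 1 + G.adjMatrix ℝ) = (2 : ℝ) • 1) :
    N *ᵥ 1 = (1 / Fintype.card V : ℝ) • 1 := by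
  have hn : (Fintype.card V : ℝ) ≠ 0 := Nat.cast_ne_zero.mpr Fintype.card_ne_zero
  have h : (N * ((2 * Fintype.card V - r : ℝ) • 1 + G.adjMatrix ℝ)) *ᵥ 1 =
      (2 * Fintype.card V : ℝ) • (N *ᵥ 1) := by
    rw [← mulVec_mulVec, add_mulVec, hr.adjMatrix_mulVec_one, smul_mulVec, one_mulVec, ← add_smul,
      mulVec_smul]
    congr 1
    ring
  rw [hN, smul_mulVec, one_mulVec] at h
  ext v
  have hv := congrFun h v
  simp only [Pi.smul_apply, Pi.one_apply, smul_eq_mul] at hv ⊢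
  field_simp
  linarith

theorem IsRegularOfDegree.lapMatrix_mul_centralGreen (hr : G.IsRegularOfDegree r) [Nonempty V]
    (hsymm : Nᵀ = N)
    (hN : ((2 * Fintype.card V - r : ℝ) • 1 + G.adjMatrix ℝ) * N = (2 : ℝ) • 1)
    (hN1 : N *ᵥ 1 = (1 / Fintype.card V : ℝ) • 1) :
    G.centralGraph.lapMatrix ℝ * G.centralGreen N =
      1 - vecMulVec (Sum.elim ((1 / Fintype.card V : ℝ) • 1) 0) 1 := by
  set n : ℝ := (Fintype.card V : ℝ)
  set B := G.edgeIncMatrix with hB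
  have hBB : B * Bᵀ = (r : ℝ) • 1 + G.adjMatrix ℝ := by
    rw [hB, edgeIncMatrix_mul_transpose, hr.incMatrix_mul_transpose]
  have hJN : vecMulVec (1 : V → ℝ) (1 : V → ℝ) * N =
      (1 / n) • vecMulVec (1 : V → ℝ) (1 : V → ℝ) := by
    rw [vecMulVec_mul, ← mulVec_transpose, hsymm, hN1]
    ext u v
    simp [vecMulVec_apply]
  have hJB : vecMulVec (1 : V → ℝ) (1 : V → ℝ) * B =
      (2 : ℝ) • vecMulVec (1 : V → ℝ) (1 : G.edgeSet → ℝ) := by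
    rw [vecMulVec_mul, hB, one_vecMul_edgeIncMatrix]
    ext u e
    simp [vecMulVec_apply]
  -- The Schur complement of the edge block is half of `(2n - r) + A`, minus the all-ones matrix.
  have hK : (n • 1 - vecMulVec 1 1 + G.adjMatrix ℝ) * N =
      1 - (1 / n) • vecMulVec (1 : V → ℝ) (1 : V → ℝ) + (1 / 2 : ℝ) • (B * Bᵀ * N) := by
    have h1 : n • 1 - vecMulVec 1 1 + G.adjMatrix ℝ =
        (1 / 2 : ℝ) • ((2 * n - r : ℝ) • 1 + G.adjMatrix ℝ) - vecMulVec 1 1 +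
          (1 / 2 : ℝ) • (B * Bᵀ) := by
      rw [hBB]
      module
    rw [h1, Matrix.add_mul, Matrix.sub_mul, Matrix.smul_mul, hN, hJN, Matrix.smul_mul]
    module
  have hv : vecMulVec (Sum.elim ((1 / n : ℝ) • (1 : V → ℝ)) (0 : G.edgeSet → ℝ))
      (1 : V ⊕ G.edgeSet → ℝ) =
      fromBlocks ((1 / n) • vecMulVec 1 1) ((1 / n) • vecMulVec 1 1) 0 0 := by
    ext (u | e) (v | f) <;> simp [vecMulVec_apply]
  have hL : G.centralGraph.lapMatrix ℝ =
      fromBlocks (n • 1 - vecMulVec 1 1 + G.adjMatrix ℝ) (-B) (-Bᵀ) ((2 : ℝ) • 1) :=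
    hr.lapMatrix_centralGraph
  rw [hL, centralGreen, fromBlocks_multiply, hv, ← fromBlocks_one,
    sub_eq_add_neg (fromBlocks 1 0 0 1), fromBlocks_neg, fromBlocks_add, ← hB]
  congr 1
  · rw [hK, Matrix.mul_smul, Matrix.neg_mul, Matrix.mul_assoc]
    module
  · rw [Matrix.mul_smul, ← Matrix.mul_assoc, hK, Matrix.add_mul, Matrix.sub_mul, Matrix.smul_mul,
      hJB, Matrix.mul_add, Matrix.mul_smul, Matrix.mul_smul]
    simp only [Matrix.neg_mul, Matrix.smul_mul, Matrix.one_mul, Matrix.mul_one, Matrix.mul_assoc]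
    module
  · rw [Matrix.neg_mul, Matrix.smul_mul, Matrix.one_mul]
    module
  · rw [Matrix.mul_smul, Matrix.smul_mul, Matrix.neg_mul, Matrix.one_mul, Matrix.mul_assoc]
    module

/-- The diagonal of the edge block is reduced to the trace of `N` by cyclicity of the trace and
`B Bᵀ = r + A`. -/
theorem IsRegularOfDegree.sum_degree_mul_centralGreen (hr : G.IsRegularOfDegree r)
    (hN : N * ((2 * Fintype.card V - r : ℝ) • 1 + G.adjMatrix ℝ) = (2 : ℝ) • 1) :
    ∑ x, Sum.elim (((Fintype.card V : ℝ) - 1) • (1 : V → ℝ))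
        ((2 : ℝ) • (1 : G.edgeSet → ℝ)) x * G.centralGreen N x x =
      (r - 1) * N.trace + Fintype.card G.edgeSet + Fintype.card V := by
  set n : ℝ := (Fintype.card V : ℝ)
  have hNA : N * ((r : ℝ) • 1 + G.adjMatrix ℝ) = (2 : ℝ) • 1 + (2 * (r - n)) • N := by
    have h1 : (r : ℝ) • 1 + G.adjMatrix ℝ =
        ((2 * n - r : ℝ) • 1 + G.adjMatrix ℝ) + (2 * (r - n)) • 1 := by
      module
    rw [h1, Matrix.mul_add, hN, Matrix.mul_smul, Matrix.mul_one]
  have htr : (G.edgeIncMatrixᵀ * N * G.edgeIncMatrix).trace = 2 * n + 2 * (r - n) * N.trace := by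
    rw [Matrix.mul_assoc, Matrix.trace_mul_comm, Matrix.mul_assoc, edgeIncMatrix_mul_transpose,
      hr.incMatrix_mul_transpose, hNA, trace_add, trace_smul, trace_smul, trace_one, smul_eq_mul,
      smul_eq_mul]
  rw [Fintype.sum_sum_type]
  simp only [Sum.elim_inl, Sum.elim_inr, centralGreen, fromBlocks_apply₁₁, fromBlocks_apply₂₂,
    Pi.smul_apply, Pi.one_apply, ← Finset.mul_sum]
  have h2 : ∑ e, ((1 / 2 : ℝ) • (1 : Matrix G.edgeSet G.edgeSet ℝ) +
      (1 / 4 : ℝ) • (G.edgeIncMatrixᵀ * N * G.edgeIncMatrix)) e e =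
      1 / 2 * Fintype.card G.edgeSet + 1 / 4 * (2 * n + 2 * (r - n) * N.trace) := by
    rw [← htr]
    change Matrix.trace _ = _
    rw [trace_add, trace_smul, trace_smul, trace_one, smul_eq_mul, smul_eq_mul]
  rw [h2]
  change (n - 1) • 1 * N.trace + _ = _
  simp only [smul_eq_mul]
  ring

theorem IsRegularOfDegree.degree_dotProduct_centralGreen (hr : G.IsRegularOfDegree r) [Nonempty V]
    (hN1 : N *ᵥ 1 = (1 / Fintype.card V : ℝ) • 1) :
    (Sum.elim (((Fintype.card V : ℝ) - 1) • (1 : V → ℝ)) ((2 : ℝ) • (1 : G.edgeSet → ℝ))) ⬝ᵥ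
        G.centralGreen N *ᵥ
          (Sum.elim (((Fintype.card V : ℝ) - 1) • (1 : V → ℝ)) ((2 : ℝ) • (1 : G.edgeSet → ℝ))) =
      (Fintype.card V - 1) * (Fintype.card V - 1 + r) +
        2 * Fintype.card G.edgeSet * (1 + (Fintype.card V - 1 + r) / Fintype.card V) := by
  have hn : (Fintype.card V : ℝ) ≠ 0 := Nat.cast_ne_zero.mpr Fintype.card_ne_zero
  set n : ℝ := (Fintype.card V : ℝ)
  have hBt : G.edgeIncMatrixᵀ *ᵥ 1 = (2 : ℝ) • 1 := by
    rw [mulVec_transpose, one_vecMul_edgeIncMatrix]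
  have h : G.centralGreen N *ᵥ
      Sum.elim ((n - 1) • (1 : V → ℝ)) ((2 : ℝ) • (1 : G.edgeSet → ℝ)) =
      Sum.elim (((n - 1 + r) / n) • 1) ((1 + (n - 1 + r) / n) • 1) := by
    rw [centralGreen, fromBlocks_mulVec]
    simp only [Sum.elim_comp_inl, Sum.elim_comp_inr, mulVec_smul, smul_mulVec, add_mulVec,
      ← mulVec_mulVec, one_mulVec, hN1, hBt, hr.edgeIncMatrix_mulVec_one, smul_smul, ← add_smul]
    congr 2
    · field_simp
    · field_simp
      ring
  rw [h, sumElim_dotProduct_sumElim]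
  simp only [smul_dotProduct, dotProduct_smul, one_dotProduct_one, smul_eq_mul]
  change _ * (_ * n) + _ = _
  field_simp

end CentralGraph

end SimpleGraph

/-! ### The degree Kirchhoff index of the central graph -/

theorem mainTheorem11 {V : Type*} [Fintype V] [DecidableEq V] (G : SimpleGraph V)
    [DecidableRel G.Adj] (n m r : ℕ) (hn : Fintype.card V = n) (hn2 : 2 ≤ n)
    (hm : G.edgeFinset.card = m) (hr : G.IsRegularOfDegree r) :
    G.centralGraph.Connected ∧
      G.centralGraph.degreeKirchhoffIndex =
        (2 * (m : ℝ) + (n : ℝ) * ((n : ℝ) - 1)) *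
          ((m : ℝ) - (n : ℝ) + ((n : ℝ) - 1) / ((n : ℝ) - 1 + (r : ℝ)) +
            ∑ i ∈ Finset.univ.filter (fun i : Fin (Fintype.card V) => 1 ≤ (i : ℕ)),
              2 * (2 * (n : ℝ) + G.adjEigenvalue i - 1) /
                (2 * (n : ℝ) + G.adjEigenvalue i - (r : ℝ))) := by
  have : Nonempty V := Fintype.card_pos_iff.mp (by omega)
  refine ⟨SimpleGraph.centralGraph_connected, ?_⟩
  have hA := G.isHermitian_adjMatrix (R := ℝ)
  have hrn : (r : ℝ) + 1 ≤ n := by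
    obtain ⟨v⟩ := this
    have h := G.degree_lt_card_verts v
    rw [hr.degree_eq, hn] at h
    exact_mod_cast h
  -- Since `λ ≥ -r` and `r ≤ n - 1`, the denominators `2n + λ - r` are positive.
  have hpos : ∀ i, 0 < (2 * n - r : ℝ) + hA.eigenvalues i := fun i => by
    linarith [hr.neg_le_eigenvalues i]
  have hn0 : (n : ℝ) ≠ 0 := by positivity
  have hn2' : (2 : ℝ) ≤ n := by exact_mod_cast hn2
  have hr0 : (0 : ℝ) ≤ r := r.cast_nonneg
  have hnr : (n : ℝ) - 1 + r ≠ 0 := by linarith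
  have hmc : (Fintype.card G.edgeSet : ℝ) = m := by
    rw [← hm, SimpleGraph.edgeFinset_card]
  -- The degree sum of `G`.
  have hnm : (n : ℝ) * r = 2 * m := by
    have h := G.sum_degrees_eq_twice_card_edges
    simp only [hr.degree_eq, Finset.sum_const, Finset.card_univ, hn, hm, smul_eq_mul] at h
    exact_mod_cast h
  obtain ⟨hinv, htr⟩ := hA.trace_inv_smul_one_add (2 * n - r : ℝ) fun i => (hpos i).ne'
  set M := (2 * n - r : ℝ) • 1 + G.adjMatrix ℝ with hM
  set N := (2 : ℝ) • M⁻¹ with hNdef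
  have hMN : M * N = (2 : ℝ) • 1 := by rw [hNdef, Matrix.mul_smul, hinv]
  have hNM : N * M = (2 : ℝ) • 1 := by
    rw [hNdef, Matrix.smul_mul, mul_eq_one_comm.mp hinv]
  have hsymm : Nᵀ = N := by
    rw [hNdef, transpose_smul, transpose_nonsing_inv, hM, transpose_add, transpose_smul,
      transpose_one, SimpleGraph.transpose_adjMatrix]
  rw [hM, ← hn] at hMN hNM
  have hN1 := hr.mulVec_one_of_mul_eq hNM
  rw [SimpleGraph.degreeKirchhoffIndex_eq_of_lapMatrix_mul
    (SimpleGraph.transpose_centralGreen hsymm) (hr.lapMatrix_mul_centralGreen hsymm hMN hN1)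
    hr.degree_centralGraph, hr.sum_degree_mul_centralGreen hNM,
    hr.degree_dotProduct_centralGreen hN1,
    hr.sum_adjEigenvalue_filter fun x => 2 * (2 * (n : ℝ) + x - 1) / (2 * (n : ℝ) + x - (r : ℝ))]
  have hsum : ∑ i, 2 * (2 * (n : ℝ) + hA.eigenvalues i - 1) /
      (2 * (n : ℝ) + hA.eigenvalues i - (r : ℝ)) = 2 * n + (r - 1) * N.trace := by
    rw [hNdef, trace_smul, htr, smul_eq_mul, Finset.mul_sum, Finset.mul_sum]
    have h2n : (2 * n : ℝ) = ∑ _i : V, (2 : ℝ) := by simp [hn, mul_comm]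
    rw [h2n, ← Finset.sum_add_distrib, ← h2n]
    refine Finset.sum_congr rfl fun i _ => ?_
    have h1 : (2 * n - r : ℝ) + hA.eigenvalues i ≠ 0 := (hpos i).ne'
    have h2 : 2 * (n : ℝ) + hA.eigenvalues i - r = (2 * n - r : ℝ) + hA.eigenvalues i := by ring
    rw [h2]
    field_simp
    ring
  have hd : ∑ x, Sum.elim (((Fintype.card V : ℝ) - 1) • (1 : V → ℝ))
      ((2 : ℝ) • (1 : G.edgeSet → ℝ)) x = n * (n - 1) + 2 * m := by
    rw [Fintype.sum_sum_type]
    simp only [Sum.elim_inl, Sum.elim_inr, Pi.smul_apply, Pi.one_apply, smul_eq_mul, mul_one,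
      Finset.sum_const, Finset.card_univ, nsmul_eq_mul, hn, hmc]
    ring
  rw [hsum, hd, hmc, hn]
  have h2n : 2 * (n : ℝ) + r - r = 2 * n := by ring
  rw [h2n]
  have hm' : (m : ℝ) = n * r / 2 := by linarith
  rw [hm']
  field_simp
  ring
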